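/- Let $\kappa_0,\kappa_1,\kappa_t\in\mathbb C$ and $c\in\mathbb C\setminus\{0,1\}$. Put $E(\lambda)=\lambda(\lambda-1)(\lambda-c)$, $F(\lambda)=\kappa_0(\lambda-1)(\lambda-c)+\kappa_1\lambda(\lambda-c)+(\kappa_t+1)\lambda(\lambda-1)$, and $$a=\frac{E'}{2E},\quad b=\frac{c(c-1)}{2E},\quad d=\frac{2EF'-E'F}{4E^2},\quad e=\frac{-(2\lambda-1)E+\lambda(\lambda-1)E'}{2E^2},\quad f=-\frac{c(c-1)F}{4E^2},\quad g=\frac{(2c-1)E+c(c-1)\lambda(\lambda-1)}{2E^2}.$$ The second variational equation $E_2$ of the sixth Painlevé foliation along the vertical leaf at infinity over $t=c$, $\mathbb P^1\setminus\{0,1,c,\infty\}$, is the linear system $$\frac{d}{d\lambda}\begin{pmatrix}\eta_2\\ \xi_2\\ u_1\\ v_1\end{pmatrix}=\begin{pmatrix}0&b&g&f\\0&a&e&d\\0&0&a&b\\0&0&0&2a\end{pmatrix}\begin{pmatrix}\eta_2\\ \xi_2\\ u_1\\ v_1\end{pmatrix}.$$ Let $S_c$ be the elliptic curve $y^2=\lambda(\lambda-1)(\lambda-c)$,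 let $Q\in S_c$ be a point which is not one of the ramification points of the double covering $(\lambda,y)\mapsto\lambda$ (these lie over $\lambda=0,1,c,\infty$), let $P$ be its image, and fix a fundamental matrix $X$ of solutions of $E_2$ near $P$. Analytic continuation of $X$ along any closed loop $\gamma$ at $P$ in $\mathbb P^1\setminus\{0,1,c,\infty\}$ gives $XT_\gamma$ for a unique invertible constant matrix $T_\gamma$, the monodromy matrix along $\gamma$; the monodromy group of $E_2$ is the group generated by all the $T_\gamma$. For a closed loop $\alpha$ on $S_c$ avoiding the ramification points, $T_\alpha$ denotes the monodromy matrix along the projection of $\alpha$. Then: 1. $T_\alpha T_\beta=T_\beta T_\alpha$ for all closed loops $\alpha,\beta$ on $S_c$ at $Q$ that avoid the ramification points; 2. the matrices $T_\alpha$, for $\alpha$ as in 1, generate a subgroup of finite index in the monodromy group of $E_2$; 3. the monodromy group of $E_2$ is virtually commutative, i.e. it has a commutative normal subgroup with finite quotient. -/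

import Mathlib

open Topology

noncomputable section

namespace PainleveSix

/-- The polynomial `E(t, z) = z (z - 1) (z - t)`. -/
def polyE (t z : ℂ) : ℂ := z * (z - 1) * (z - t)

/-- The polynomial `F(t, z)`, with the parameters `k0, k1, kt` of the sixth Painleve equation. -/
def polyF (k0 k1 kt t z : ℂ) : ℂ :=
  k0 * (z - 1) * (z - t) + k1 * z * (z - t) + (kt + 1) * z * (z - 1)

/-- The partial derivative of `E` with respect to the second variable. -/
def polyEDeriv (t z : ℂ) : ℂ := deriv (fun w => polyE t w) z

/-- The partial derivative of `F` with respect to the second variable. -/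
def polyFDeriv (k0 k1 kt t z : ℂ) : ℂ := deriv (fun w => polyF k0 k1 kt t w) z

def coeffA (c z : ℂ) : ℂ := polyEDeriv c z / (2 * polyE c z)

def coeffB (c z : ℂ) : ℂ := c * (c - 1) / (2 * polyE c z)

def coeffD (k0 k1 kt c z : ℂ) : ℂ :=
  (2 * polyE c z * polyFDeriv k0 k1 kt c z - polyEDeriv c z * polyF k0 k1 kt c z)
    / (4 * polyE c z ^ 2)

def coeffE (c z : ℂ) : ℂ :=
  (-(2 * z - 1) * polyE c z + z * (z - 1) * polyEDeriv c z) / (2 * polyE c z ^ 2)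

def coeffF (k0 k1 kt c z : ℂ) : ℂ :=
  -(c * (c - 1) * polyF k0 k1 kt c z) / (4 * polyE c z ^ 2)

def coeffG (c z : ℂ) : ℂ :=
  ((2 * c - 1) * polyE c z + c * (c - 1) * (z * (z - 1))) / (2 * polyE c z ^ 2)

/-- The coefficient matrix of the second variational equation, written as a linear system
for the column vector `(η₂, ξ₂, u₁, v₁)`, where `u₁ = ξ₁ η₁` and `v₁ = ξ₁ ^ 2`. -/
def secondVariational (k0 k1 kt c z : ℂ) : Matrix (Fin 4) (Fin 4) ℂ :=
  !![0, coeffB c z, coeffG c z, coeffF k0 k1 kt c z;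
     0, coeffA c z, coeffE c z, coeffD k0 k1 kt c z;
     0, 0, coeffA c z, coeffB c z;
     0, 0, 0, 2 * coeffA c z]

/-- The leaf: the Riemann sphere punctured at `0, 1, c, ∞`. -/
def Leaf (c : ℂ) : Type := {z : ℂ // z ≠ 0 ∧ z ≠ 1 ∧ z ≠ c}

instance (c : ℂ) : TopologicalSpace (Leaf c) :=
  inferInstanceAs (TopologicalSpace {z : ℂ // z ≠ 0 ∧ z ≠ 1 ∧ z ≠ c})

/-- The elliptic curve `y ^ 2 = z (z - 1) (z - c)` without its four ramification points
over `z = 0, 1, c, ∞`. -/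
def Curve (c : ℂ) : Type :=
  {p : ℂ × ℂ // p.2 ^ 2 = p.1 * (p.1 - 1) * (p.1 - c) ∧ p.1 ≠ 0 ∧ p.1 ≠ 1 ∧ p.1 ≠ c}

instance (c : ℂ) : TopologicalSpace (Curve c) :=
  inferInstanceAs (TopologicalSpace
    {p : ℂ × ℂ // p.2 ^ 2 = p.1 * (p.1 - 1) * (p.1 - c) ∧ p.1 ≠ 0 ∧ p.1 ≠ 1 ∧ p.1 ≠ c})

/-- The double covering `(z, y) ↦ z`. -/
def Curve.proj {c : ℂ} (q : Curve c) : Leaf c := ⟨q.1.1, q.2.2⟩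

theorem Curve.continuous_proj {c : ℂ} : Continuous (Curve.proj (c := c)) :=
  Continuous.subtype_mk (continuous_fst.comp continuous_subtype_val) _

/-- `Φ` is an analytic continuation along the path `γ` of a matrix solution of the linear system
`W' = A W`: near each time `s₀`, it is obtained by evaluating along `γ` one holomorphic
solution defined in a neighbourhood of `γ s₀`. -/
def IsContinuationAlong (A : ℂ → Matrix (Fin 4) (Fin 4) ℂ) (γ : unitInterval → ℂ)
    (Φ : unitInterval → Matrix (Fin 4) (Fin 4) ℂ) : Prop :=
  ∀ s₀ : unitInterval, ∃ W : ℂ → Matrix (Fin 4) (Fin 4) ℂ,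
    (∀ᶠ z in 𝓝 (γ s₀), ∀ i j, HasDerivAt (fun w => W w i j) ((A z * W z) i j) z) ∧
    ∀ᶠ s in 𝓝 s₀, Φ s = W (γ s)

/-- `T` is the monodromy matrix along the loop `γ` of the second variational equation, with respect
to the fundamental matrix of solutions whose value at the base point is `X`: the continuation of
this fundamental matrix along `γ` turns it into itself times `T`. -/
def IsMonodromyMatrix (k0 k1 kt c : ℂ) {P : Leaf c} (γ : Path P P)
    (X T : GL (Fin 4) ℂ) : Prop :=
  ∃ Φ : unitInterval → Matrix (Fin 4) (Fin 4) ℂ,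
    IsContinuationAlong (secondVariational k0 k1 kt c) (fun s => (γ s).1) Φ ∧
    Φ 0 = X.1 ∧ Φ 1 = X.1 * T.1

/-- The monodromy group, generated by the monodromy matrices along all loops at `P` in the leaf. -/
def monodromyGroup (k0 k1 kt c : ℂ) (P : Leaf c) (X : GL (Fin 4) ℂ) : Subgroup (GL (Fin 4) ℂ) :=
  Subgroup.closure {T | ∃ γ : Path P P, IsMonodromyMatrix k0 k1 kt c γ X T}

/-- `T` is the monodromy matrix along (the projection of) a loop on the elliptic curve. -/
def IsCurveMonodromyMatrix (k0 k1 kt c : ℂ) {Q : Curve c} (α : Path Q Q)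
    (X T : GL (Fin 4) ℂ) : Prop :=
  IsMonodromyMatrix k0 k1 kt c (α.map Curve.continuous_proj) X T

/-- The group generated by the monodromy matrices along the loops at `Q` on the elliptic curve. -/
def curveMonodromyGroup (k0 k1 kt c : ℂ) (Q : Curve c) (X : GL (Fin 4) ℂ) :
    Subgroup (GL (Fin 4) ℂ) :=
  Subgroup.closure {T | ∃ α : Path Q Q, IsCurveMonodromyMatrix k0 k1 kt c α X T}

/-- A group is virtually commutative if it has a commutative normal subgroup with finite
quotient. -/
def IsVirtuallyCommutative (G : Type*) [Group G] : Prop :=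
  ∃ N : Subgroup G, N.Normal ∧ (∀ a ∈ N, ∀ b ∈ N, a * b = b * a) ∧ Finite (G ⧸ N)

end PainleveSix

end

/-! The system is solvable in closed form. Locally, let y be a square root of E, and let p and r be
primitives of dλ/y and dλ/((λ-c)y). The triangular system then has the fundamental matrix
`algFactor` * `unipFactor`, the first factor algebraic on the curve, the second polynomial in p and
r (`hasDerivAt_fundamentalMatrix`). The top right entry, a priori an iterated integral, has an exact
integrand and becomes a quadratic form in p and r. This makes `unipFactor` a homomorphism from the
additive group ℂ² (`unipFactor_mul`).

Along a loop on the curve y returns to its initial value, and so does the algebraic factor, while p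
and r change by additive constants. All these monodromy matrices are thus values of `unipFactor`
conjugated by one fixed matrix, and they commute. A loop in the leaf lifts to a loop on the curve or
to a path ending on the opposite sheet (`exists_lift_loop`), and two paths of the second kind
combine into a loop, so the index is at most two (`isFiniteRelIndex_closure_union`). Continuations
exist by gluing local frames (`exists_isFrameLiftAt`) and are unique by
`IsContinuationAlong.eq_of_zero_eq`. -/

noncomputable section

namespace PainleveSix

/-! ### Gluing along the unit interval -/

/-- Gluing of local sections over the unit interval: if local sections through every point of the
fibres exist on uniform neighbourhoods and their germs are determined by one value, then there is a
global section with prescribed value at `0`. -/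
theorem exists_global_section {V : Type*} (L : (unitInterval → V) → unitInterval → Prop)
    (F : unitInterval → V → Prop)
    (hcongr : ∀ g g' s, g =ᶠ[𝓝 s] g' → L g s → L g' s)
    (hfib : ∀ g s, L g s → F s (g s))
    (hloc : ∀ s, ∃ U ∈ 𝓝 s, ∀ r ∈ U, ∀ v, F r v → ∃ g, g r = v ∧ ∀ r' ∈ U, L g r')
    (huniq : ∀ g g' s, L g s → L g' s → g s = g' s → g =ᶠ[𝓝 s] g')
    (v : V) (hv : F 0 v) : ∃ g, g 0 = v ∧ ∀ s, L g s := by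
  set P : unitInterval → Prop := fun t => ∃ g, g 0 = v ∧ ∀ s ≤ t, L g s with hP
  have step : ∀ U : Set unitInterval, (∀ r ∈ U, ∀ v, F r v → ∃ g, g r = v ∧ ∀ r' ∈ U, L g r') →
      ∀ t t', Set.uIcc t t' ⊆ U → P t → P t' := by
    rintro U hU t t' hsub ⟨g, hg0, hg⟩
    rcases le_or_gt t' t with h | h
    · exact ⟨g, hg0, fun s hs => hg s (hs.trans h)⟩
    · obtain ⟨f, hft, hf⟩ := hU t (hsub Set.left_mem_uIcc) (g t) (hfib _ _ (hg t le_rfl))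
      have hgf : g =ᶠ[𝓝 t] f :=
        huniq g f t (hg t le_rfl) (hf t (hsub Set.left_mem_uIcc)) hft.symm
      refine ⟨fun r => if r ≤ t then g r else f r, ?_, fun s hs => ?_⟩
      · simp [hg0]
      rcases lt_trichotomy s t with hst | rfl | hst
      · refine hcongr g _ s ?_ (hg s hst.le)
        filter_upwards [Iio_mem_nhds hst] with r hr
        rw [if_pos (le_of_lt hr)]
      · refine hcongr g _ s ?_ (hg s le_rfl)
        filter_upwards [hgf] with r hr
        split_ifs <;> simp [hr]
      · refine hcongr f _ s ?_ (hf s (hsub (Set.mem_uIcc_of_le hst.le hs)))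
        filter_upwards [Ioi_mem_nhds hst] with r hr
        rw [if_neg (not_le.2 hr)]
  have h0 : P 0 := by
    obtain ⟨U, hU, h⟩ := hloc 0
    obtain ⟨g, hg0, hg⟩ := h 0 (mem_of_mem_nhds hU) v hv
    refine ⟨g, hg0, fun s hs => ?_⟩
    have : s = 0 := le_antisymm hs s.2.1
    exact this ▸ hg 0 (mem_of_mem_nhds hU)
  have h1 : P 0 → P 1 := by
    -- Connectedness induction needs the implication both ways between nearby points, hence the
    -- unordered intervals in `step`.
    refine isPreconnected_univ.induction₂' (fun x y => P x → P y) (fun x _ => ?_)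
      (fun x y z _ _ _ h1 h2 h => h2 (h1 h)) (Set.mem_univ 0) (Set.mem_univ 1)
    obtain ⟨U, hU, h⟩ := hloc x
    have hev : ∀ᶠ y in 𝓝 x, Set.uIcc x y ⊆ U := by
      have := (tendsto_const_nhds (x := x)).uIcc (Filter.tendsto_id (x := 𝓝 x))
      exact (this.eventually (Filter.eventually_smallSets_subset.2 hU))
    rw [nhdsWithin_univ]
    filter_upwards [hev] with y hy
    exact ⟨step U h x y hy, step U h y x (by rwa [Set.uIcc_comm])⟩
  obtain ⟨g, hg0, hg⟩ := h1 h0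
  exact ⟨g, hg0, fun s => hg s s.2.2⟩

/-! ### Finite index and virtual commutativity -/

/-- `A` plays the even generators and `B` the odd ones: for any odd `t`, the cosets of 1 and t⁻¹
exhaust the larger group. -/
theorem isFiniteRelIndex_closure_union {G : Type*} [Group G] (A B : Set G)
    (hAB : ∀ a ∈ A, ∀ b ∈ B, b * a ∈ B) (hBB : ∀ a ∈ B, ∀ b ∈ B, a * b ∈ A) :
    (Subgroup.closure A).IsFiniteRelIndex (Subgroup.closure (A ∪ B)) := by
  rcases B.eq_empty_or_nonempty with rfl | ⟨t, ht⟩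
  · rw [Set.union_empty]
    exact ⟨by rw [Subgroup.relIndex_self]; exact one_ne_zero⟩
  have hA : ∀ a ∈ A, a ∈ Subgroup.closure A := fun a ha => Subgroup.subset_closure ha
  have htt := hA _ (hBB t ht t ht)
  have hconj : ∀ x ∈ Subgroup.closure A, t * x * t⁻¹ ∈ Subgroup.closure A := by
    intro x hx
    induction hx using Subgroup.closure_induction with
    | mem x hx =>
      have := mul_mem (hA _ (hBB _ (hAB x hx t ht) t ht)) (inv_mem htt)
      simpa [mul_assoc] using this
    | one => simp
    | mul x y _ _ hx hy => simpa [mul_assoc] using mul_mem hx hy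
    | inv x _ hx => simpa [mul_assoc] using inv_mem hx
  have key : ∀ g ∈ Subgroup.closure (A ∪ B),
      g ∈ Subgroup.closure A ∨ t * g ∈ Subgroup.closure A := by
    -- Both `t * x` and `x * t` are required for odd x because the odd-odd case is x y = (x t)(t
    -- t)⁻¹(t y).
    have hgen : ∀ x y, (x ∈ Subgroup.closure A ∨
        (t * x ∈ Subgroup.closure A ∧ x * t ∈ Subgroup.closure A)) →
        (y ∈ Subgroup.closure A ∨ t * y ∈ Subgroup.closure A) →
        (x * y ∈ Subgroup.closure A ∨ t * (x * y) ∈ Subgroup.closure A) := by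
      rintro x y (hx | ⟨hx, hx'⟩) (hy | hy)
      · exact Or.inl (mul_mem hx hy)
      · right
        simpa [mul_assoc] using mul_mem (hconj x hx) hy
      · right
        simpa [mul_assoc] using mul_mem hx hy
      · left
        have := mul_mem (mul_mem hx' (inv_mem htt)) hy
        simpa [mul_assoc] using this
    intro g hg
    induction hg using Subgroup.closure_induction_left with
    | one => exact Or.inl (one_mem _)
    | mul_left x hx y _ hy =>
      refine hgen x y ?_ hy
      rcases hx with hx | hx
      · exact Or.inl (hA x hx)
      · exact Or.inr ⟨hA _ (hBB t ht x hx), hA _ (hBB x hx t ht)⟩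
    | inv_mul_cancel x hx y _ hy =>
      refine hgen x⁻¹ y ?_ hy
      rcases hx with hx | hx
      · exact Or.inl (inv_mem (hA x hx))
      · right
        constructor
        · simpa [mul_assoc] using mul_mem htt (inv_mem (hA _ (hBB x hx t ht)))
        · simpa [mul_assoc] using mul_mem (inv_mem (hA _ (hBB t ht x hx))) htt
  set K := Subgroup.closure (A ∪ B)
  set H := Subgroup.closure A
  have htK : t ∈ K := Subgroup.subset_closure (Or.inr ht)
  have hfin : (H.subgroupOf K).FiniteIndex := by
    have : Finite (K ⧸ H.subgroupOf K) := by
      refine Finite.of_surjective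
        (fun b : Bool => (QuotientGroup.mk (if b then 1 else (⟨t, htK⟩ : K)⁻¹) :
          K ⧸ H.subgroupOf K)) fun q => ?_
      obtain ⟨g, rfl⟩ := QuotientGroup.mk_surjective q
      rcases key g g.2 with h | h
      · exact ⟨true, QuotientGroup.eq.2 (by simpa [Subgroup.mem_subgroupOf] using h)⟩
      · exact ⟨false, QuotientGroup.eq.2 (by simpa [Subgroup.mem_subgroupOf] using h)⟩
    exact Subgroup.finiteIndex_of_finite_quotient
  exact ⟨hfin.index_ne_zero⟩

/-- The normal core of a finite index subgroup still has finite index, and it inherits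
commutativity. -/
theorem isVirtuallyCommutative_of_isFiniteRelIndex {G : Type*} [Group G] (H K : Subgroup G)
    (hcomm : ∀ a ∈ H, ∀ b ∈ H, a * b = b * a) [hfin : H.IsFiniteRelIndex K] :
    IsVirtuallyCommutative K := by
  have : (H.subgroupOf K).FiniteIndex := ⟨hfin.relIndex_ne_zero⟩
  refine ⟨(H.subgroupOf K).normalCore, inferInstance, fun a ha b hb => ?_, inferInstance⟩
  exact Subtype.ext (hcomm a (Subgroup.normalCore_le (H.subgroupOf K) ha) b
    (Subgroup.normalCore_le (H.subgroupOf K) hb))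

/-! ### Linear systems with a fundamental matrix -/

section LinearSystems

variable {n : Type*} [Fintype n] [DecidableEq n]

theorem differentiableAt_det {M : ℂ → Matrix n n ℂ} {z : ℂ}
    (hM : ∀ i j, DifferentiableAt ℂ (fun w => M w i j) z) :
    DifferentiableAt ℂ (fun w => (M w).det) z := by
  simp only [Matrix.det_apply]
  refine DifferentiableAt.fun_sum fun σ _ => ?_
  refine DifferentiableAt.const_smul ?_ _
  exact DifferentiableAt.fun_finsetProd fun i _ => hM _ _

theorem differentiableAt_matrix_inv {M : ℂ → Matrix n n ℂ} {z : ℂ}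
    (hM : ∀ i j, DifferentiableAt ℂ (fun w => M w i j) z) (h : (M z).det ≠ 0) (i j : n) :
    DifferentiableAt ℂ (fun w => (M w)⁻¹ i j) z := by
  simp only [Matrix.inv_def, Ring.inverse_eq_inv', Matrix.smul_apply, smul_eq_mul,
    Matrix.adjugate_apply]
  refine ((differentiableAt_det hM).fun_inv h).fun_mul (differentiableAt_det fun a b => ?_)
  by_cases hab : a = j
  · subst hab
    simp
  · simpa [Matrix.updateRow_ne hab] using hM a b

/-- Two matrix solutions of a linear system, the first of them fundamental, differ by a constant
matrix on a connected open set. -/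
theorem exists_eq_mul_of_hasDerivAt {A M V : ℂ → Matrix n n ℂ} {B : Set ℂ} (hB : IsOpen B)
    (hB' : IsPreconnected B)
    (hM : ∀ z ∈ B, ∀ i j, HasDerivAt (fun w => M w i j) ((A z * M z) i j) z)
    (hV : ∀ z ∈ B, ∀ i j, HasDerivAt (fun w => V w i j) ((A z * V z) i j) z)
    (hdet : ∀ z ∈ B, (M z).det ≠ 0) : ∃ K, ∀ z ∈ B, V z = M z * K := by
  have hMK : ∀ z ∈ B, M z * ((M z)⁻¹ * V z) = V z := fun z hz =>
    Matrix.mul_nonsing_inv_cancel_left _ _ (hdet z hz).isUnit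
  have hd : ∀ z ∈ B, ∀ i j, DifferentiableAt ℂ (fun w => ((M w)⁻¹ * V w) i j) z := by
    intro z hz i j
    simp only [Matrix.mul_apply]
    exact DifferentiableAt.fun_sum fun k _ =>
      (differentiableAt_matrix_inv (fun i j => (hM z hz i j).differentiableAt)
        (hdet z hz) i k).fun_mul (hV z hz k j).differentiableAt
  have hzero : ∀ i j, Set.EqOn (deriv fun w => ((M w)⁻¹ * V w) i j) 0 B := by
    intro i j z hz
    set K' : Matrix n n ℂ := fun i j => deriv (fun w => ((M w)⁻¹ * V w) i j) z with hK'
    -- Differentiating M (M⁻¹V) = V gives A V + M K' = A V, which avoids a formula for the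
    -- derivative of M⁻¹.
    have hprod : M z * K' = 0 := by
      ext a b
      have h1 : HasDerivAt (fun w => ∑ k, M w a k * ((M w)⁻¹ * V w) k b)
          (∑ k, ((A z * M z) a k * ((M z)⁻¹ * V z) k b + M z a k * K' k b)) z :=
        HasDerivAt.fun_sum fun k _ => (hM z hz a k).fun_mul (hd z hz k b).hasDerivAt
      have h2 : (fun w => ∑ k, M w a k * ((M w)⁻¹ * V w) k b) =ᶠ[𝓝 z] fun w => V w a b := by
        filter_upwards [hB.mem_nhds hz] with w hw
        rw [← Matrix.mul_apply, hMK w hw]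
      have h3 := h1.unique ((hV z hz a b).congr_of_eventuallyEq h2)
      rw [Finset.sum_add_distrib, ← Matrix.mul_apply, ← Matrix.mul_apply, Matrix.mul_assoc,
        hMK z hz] at h3
      simpa using h3
    have : K' = 0 := by
      rw [← Matrix.nonsing_inv_mul_cancel_left (M z) K' (hdet z hz).isUnit, hprod, Matrix.mul_zero]
    exact congrFun (congrFun this i) j
  rcases B.eq_empty_or_nonempty with rfl | ⟨z₀, hz₀⟩
  · exact ⟨0, by simp⟩
  refine ⟨(M z₀)⁻¹ * V z₀, fun z hz => ?_⟩
  rw [← hMK z hz]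
  congr 1
  ext i j
  exact hB.is_const_of_deriv_eq_zero hB'
    (fun w hw => (hd w hw i j).differentiableWithinAt) (hzero i j) hz hz₀

end LinearSystems

/-! ### Elliptic frames -/

theorem hasDerivAt_polyE (c z : ℂ) : HasDerivAt (fun w => polyE c w) (polyEDeriv c z) z := by
  have : DifferentiableAt ℂ (fun w => polyE c w) z := by unfold polyE; fun_prop
  exact this.hasDerivAt

theorem hasDerivAt_polyF (k0 k1 kt c z : ℂ) :
    HasDerivAt (fun w => polyF k0 k1 kt c w) (polyFDeriv k0 k1 kt c z) z := by
  have : DifferentiableAt ℂ (fun w => polyF k0 k1 kt c w) z := by unfold polyF; fun_prop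
  exact this.hasDerivAt

theorem polyEDeriv_eq (c z : ℂ) :
    polyEDeriv c z = (z - 1) * (z - c) + z * (z - c) + z * (z - 1) := by
  refine (hasDerivAt_polyE c z).unique ?_
  have := (((hasDerivAt_id z).mul ((hasDerivAt_id z).sub_const 1)).mul
    ((hasDerivAt_id z).sub_const c))
  refine this.congr_deriv ?_
  simp only [id]
  simp
  ring

theorem polyE_ne_zero {c z : ℂ} (h0 : z ≠ 0) (h1 : z ≠ 1) (hc : z ≠ c) : polyE c z ≠ 0 :=
  mul_ne_zero (mul_ne_zero h0 (sub_ne_zero.2 h1)) (sub_ne_zero.2 hc)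

theorem ne_of_polyE_ne_zero {c z : ℂ} (h : polyE c z ≠ 0) : z ≠ 0 ∧ z ≠ 1 ∧ z ≠ c := by
  refine ⟨?_, ?_, ?_⟩ <;> rintro rfl <;> exact h (by simp [polyE])

/-- At `z`, the function `Y` is a square root of `E`, and `P`, `R` are primitives of the elliptic
differentials `dz / Y` and `dz / ((z - c) Y)`. -/
structure IsEllipticFrameAt (c : ℂ) (Y P R : ℂ → ℂ) (z : ℂ) : Prop where
  ne_zero : Y z ≠ 0
  sq_eq : Y z ^ 2 = polyE c z
  deriv_root : HasDerivAt Y (polyEDeriv c z / (2 * Y z)) z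
  deriv_first : HasDerivAt P (1 / Y z) z
  deriv_second : HasDerivAt R (1 / ((z - c) * Y z)) z

theorem IsEllipticFrameAt.polyE_ne {c z : ℂ} {Y P R : ℂ → ℂ} (h : IsEllipticFrameAt c Y P R z) :
    polyE c z ≠ 0 := h.sq_eq ▸ pow_ne_zero 2 h.ne_zero

theorem exists_ball_isEllipticFrameAt {c z₀ : ℂ} (h : polyE c z₀ ≠ 0) :
    ∃ r > 0, ∃ Y P R : ℂ → ℂ, ∀ z ∈ Metric.ball z₀ r, IsEllipticFrameAt c Y P R z := by
  obtain ⟨y₀, hy₀⟩ := IsAlgClosed.exists_pow_nat_eq (polyE c z₀) two_pos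
  have hy₀0 : y₀ ≠ 0 := by
    rintro rfl
    exact h (by rw [← hy₀]; simp)
  -- Dividing by the value at `z₀` puts the quotient near 1, inside the domain of the principal
  -- logarithm; `y₀` restores the scale.
  have hcont : ContinuousAt (fun z => polyE c z / polyE c z₀) z₀ :=
    (hasDerivAt_polyE c z₀).continuousAt.div_const _
  have hslit : ∀ᶠ z in 𝓝 z₀, polyE c z / polyE c z₀ ∈ Complex.slitPlane := by
    refine hcont.eventually (Complex.isOpen_slitPlane.mem_nhds ?_)
    simp [div_self h]
  obtain ⟨r, hr, hball⟩ := Metric.eventually_nhds_iff_ball.1 hslit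
  set Y : ℂ → ℂ := fun z => y₀ * Complex.exp (Complex.log (polyE c z / polyE c z₀) / 2) with hYdef
  have hE : ∀ z ∈ Metric.ball z₀ r, polyE c z ≠ 0 := fun z hz h0 =>
    Complex.slitPlane_ne_zero (hball z hz) (by simp [h0])
  have hY0 : ∀ z, Y z ≠ 0 := fun z => mul_ne_zero hy₀0 (Complex.exp_ne_zero _)
  have hYsq : ∀ z ∈ Metric.ball z₀ r, Y z ^ 2 = polyE c z := by
    intro z hz
    rw [hYdef]
    simp only
    rw [mul_pow, ← Complex.exp_nat_mul, hy₀, Nat.cast_ofNat, mul_div_cancel₀ _ two_ne_zero,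
      Complex.exp_log (Complex.slitPlane_ne_zero (hball z hz)), mul_div_cancel₀ _ h]
  have hYd : ∀ z ∈ Metric.ball z₀ r, HasDerivAt Y (polyEDeriv c z / (2 * Y z)) z := by
    intro z hz
    have h1 := (((((hasDerivAt_polyE c z).div_const (polyE c z₀)).clog (hball z hz)).div_const
      2).cexp).const_mul y₀
    refine h1.congr_deriv ?_
    have h2 := hYsq z hz
    have h3 := hY0 z
    have h4 := hE z hz
    rw [eq_div_iff (mul_ne_zero two_ne_zero h3)]
    calc _ = Y z ^ 2 * polyEDeriv c z / polyE c z := by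
          rw [hYdef]
          field_simp
      _ = _ := by rw [h2]; field_simp
  have hd1 : DifferentiableOn ℂ (fun z => 1 / Y z) (Metric.ball z₀ r) := fun z hz =>
    ((differentiableAt_const _).fun_div (hYd z hz).differentiableAt
      (hY0 z)).differentiableWithinAt
  have hd2 : DifferentiableOn ℂ (fun z => 1 / ((z - c) * Y z)) (Metric.ball z₀ r) := fun z hz =>
    ((differentiableAt_const _).fun_div
      ((differentiableAt_id.sub_const c).fun_mul (hYd z hz).differentiableAt)
      (mul_ne_zero (sub_ne_zero.2 (ne_of_polyE_ne_zero (hE z hz)).2.2)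
        (hY0 z))).differentiableWithinAt
  obtain ⟨P, hP⟩ := hd1.isExactOn_ball
  obtain ⟨R, hR⟩ := hd2.isExactOn_ball
  exact ⟨r, hr, Y, P, R, fun z hz => ⟨hY0 z, hYsq z hz, hYd z hz, hP z hz, hR z hz⟩⟩

/-- With a sign and two additive constants, a frame can be given any value (y, p, r) with y² = E at
a point. -/
theorem IsEllipticFrameAt.transform {c z : ℂ} {Y P R : ℂ → ℂ} (h : IsEllipticFrameAt c Y P R z)
    {ε : ℂ} (hε : ε ^ 2 = 1) (p r : ℂ) :
    IsEllipticFrameAt c (fun w => ε * Y w) (fun w => ε * P w + p) (fun w => ε * R w + r) z := by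
  have hε0 : ε ≠ 0 := by rintro rfl; simp at hε
  have hy := h.ne_zero
  have hc := sub_ne_zero.2 (ne_of_polyE_ne_zero h.polyE_ne).2.2
  have hinv : ε = 1 / ε := by field_simp; exact hε
  refine ⟨mul_ne_zero hε0 hy, by rw [mul_pow, hε, one_mul, h.sq_eq], ?_, ?_, ?_⟩
  · refine (h.deriv_root.const_mul ε).congr_deriv ?_
    nth_rw 1 [hinv]
    field_simp
  · refine ((h.deriv_first.const_mul ε).add_const p).congr_deriv ?_
    nth_rw 1 [hinv]
    field_simp
  · refine ((h.deriv_second.const_mul ε).add_const r).congr_deriv ?_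
    nth_rw 1 [hinv]
    field_simp

/-- Two nonvanishing square roots agreeing at one point of a connected set agree on it; the
primitives then have equal derivatives. -/
theorem eqOn_of_isEllipticFrameAt {c z₀ : ℂ} {B : Set ℂ} (hB : IsOpen B) (hB' : IsPreconnected B)
    {Y P R Y' P' R' : ℂ → ℂ} (h : ∀ z ∈ B, IsEllipticFrameAt c Y P R z)
    (h' : ∀ z ∈ B, IsEllipticFrameAt c Y' P' R' z) (hz₀ : z₀ ∈ B) (hY : Y z₀ = Y' z₀)
    (hP : P z₀ = P' z₀) (hR : R z₀ = R' z₀) :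
    Set.EqOn Y Y' B ∧ Set.EqOn P P' B ∧ Set.EqOn R R' B := by
  have hYY : Set.EqOn Y Y' B := hB'.eq_of_sq_eq
    (fun z hz => (h z hz).deriv_root.continuousAt.continuousWithinAt)
    (fun z hz => (h' z hz).deriv_root.continuousAt.continuousWithinAt)
    (fun z hz => by simp [(h z hz).sq_eq, (h' z hz).sq_eq]) (fun {z} hz => (h' z hz).ne_zero)
    hz₀ hY
  refine ⟨hYY, ?_, ?_⟩
  · refine hB.eqOn_of_deriv_eq hB'
      (fun z hz => (h z hz).deriv_first.differentiableAt.differentiableWithinAt)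
      (fun z hz => (h' z hz).deriv_first.differentiableAt.differentiableWithinAt)
      (fun z hz => ?_) hz₀ hP
    rw [(h z hz).deriv_first.deriv, (h' z hz).deriv_first.deriv, hYY hz]
  · refine hB.eqOn_of_deriv_eq hB'
      (fun z hz => (h z hz).deriv_second.differentiableAt.differentiableWithinAt)
      (fun z hz => (h' z hz).deriv_second.differentiableAt.differentiableWithinAt)
      (fun z hz => ?_) hz₀ hR
    rw [(h z hz).deriv_second.deriv, (h' z hz).deriv_second.deriv, hYY hz]

/-! ### Frames continued along a path -/

/-- Near `s`, the triple `g = (y, p, r)` is obtained by evaluating an elliptic frame along `γ`. -/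
def IsFrameLiftAt (c : ℂ) (γ : unitInterval → ℂ) (g : unitInterval → ℂ × ℂ × ℂ)
    (s : unitInterval) : Prop :=
  ∃ Y P R : ℂ → ℂ, (∀ᶠ z in 𝓝 (γ s), IsEllipticFrameAt c Y P R z) ∧
    ∀ᶠ r in 𝓝 s, g r = (Y (γ r), P (γ r), R (γ r))

/-- The primitives start at 0, so that the unipotent factor starts at the identity. -/
theorem exists_isFrameLiftAt {c : ℂ} {γ : unitInterval → ℂ} (hγ : Continuous γ)
    (hE : ∀ s, polyE c (γ s) ≠ 0) {y₀ : ℂ} (hy₀ : y₀ ^ 2 = polyE c (γ 0)) :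
    ∃ g : unitInterval → ℂ × ℂ × ℂ, g 0 = (y₀, 0, 0) ∧ ∀ s, IsFrameLiftAt c γ g s := by
  refine exists_global_section (IsFrameLiftAt c γ) (fun s v => v.1 ^ 2 = polyE c (γ s))
    ?_ ?_ ?_ ?_ _ hy₀
  · rintro g g' s hgg ⟨Y, P, R, h, hg⟩
    refine ⟨Y, P, R, h, ?_⟩
    filter_upwards [hgg, hg] with r h1 h2
    rw [← h1, h2]
  · rintro g s ⟨Y, P, R, h, hg⟩
    rw [hg.self_of_nhds]
    exact h.self_of_nhds.sq_eq
  · intro s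
    obtain ⟨ρ, hρ, Y, P, R, h⟩ := exists_ball_isEllipticFrameAt (hE s)
    refine ⟨γ ⁻¹' Metric.ball (γ s) ρ,
      hγ.continuousAt.preimage_mem_nhds (Metric.ball_mem_nhds _ hρ), ?_⟩
    rintro t ht ⟨y, p, r⟩ (hv : y ^ 2 = _)
    have ht' := h _ ht
    have hε : (y / Y (γ t)) ^ 2 = 1 := by
      rw [div_pow, hv, ht'.sq_eq, div_self ht'.polyE_ne]
    -- The sign matching the prescribed root; the constants below then match the prescribed
    -- primitives.
    set ε := y / Y (γ t) with hεdef
    refine ⟨fun u => (ε * Y (γ u), ε * P (γ u) + (p - ε * P (γ t)),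
      ε * R (γ u) + (r - ε * R (γ t))), ?_, fun u hu => ?_⟩
    · simp [hεdef, div_mul_cancel₀ y ht'.ne_zero]
    · refine ⟨fun w => ε * Y w, fun w => ε * P w + (p - ε * P (γ t)),
        fun w => ε * R w + (r - ε * R (γ t)), ?_, Filter.Eventually.of_forall fun _ => rfl⟩
      filter_upwards [Metric.isOpen_ball.mem_nhds hu] with z hz
      exact (h z hz).transform hε _ _
  · rintro g g' s ⟨Y, P, R, h, hg⟩ ⟨Y', P', R', h', hg'⟩ hs
    obtain ⟨ρ, hρ, hball⟩ := Metric.eventually_nhds_iff_ball.1 (h.and h')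
    rw [hg.self_of_nhds, hg'.self_of_nhds, Prod.mk.injEq, Prod.mk.injEq] at hs
    obtain ⟨h1, h2, h3⟩ := eqOn_of_isEllipticFrameAt Metric.isOpen_ball
      (convex_ball _ _).isPreconnected (fun z hz => (hball z hz).1) (fun z hz => (hball z hz).2)
      (Metric.mem_ball_self hρ) hs.1 hs.2.1 hs.2.2
    filter_upwards [hg, hg', hγ.continuousAt.preimage_mem_nhds (Metric.ball_mem_nhds _ hρ)]
      with r hr hr' hrb
    rw [hr, hr', h1 hrb, h2 hrb, h3 hrb]

theorem IsFrameLiftAt.continuousAt_fst {c : ℂ} {γ : unitInterval → ℂ} (hγ : Continuous γ)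
    {g : unitInterval → ℂ × ℂ × ℂ} {s : unitInterval} (h : IsFrameLiftAt c γ g s) :
    ContinuousAt (fun r => (g r).1) s := by
  obtain ⟨Y, P, R, h, hg⟩ := h
  have : ContinuousAt (fun r => Y (γ r)) s :=
    ContinuousAt.comp' h.self_of_nhds.deriv_root.continuousAt hγ.continuousAt
  refine this.congr ?_
  filter_upwards [hg] with r hr
  rw [hr]

theorem IsFrameLiftAt.sq_eq {c : ℂ} {γ : unitInterval → ℂ}
    {g : unitInterval → ℂ × ℂ × ℂ} {s : unitInterval} (h : IsFrameLiftAt c γ g s) :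
    (g s).1 ^ 2 = polyE c (γ s) := by
  obtain ⟨Y, P, R, h, hg⟩ := h
  rw [hg.self_of_nhds]
  exact h.self_of_nhds.sq_eq

/-! ### The explicit fundamental matrix -/

/-- The algebraic factor of the fundamental matrix. -/
def algFactor (k0 k1 kt c z y : ℂ) : Matrix (Fin 4) (Fin 4) ℂ :=
  !![1, 0, 0, 0;
     0, y, -(y / (2 * (z - c))), polyF k0 k1 kt c z / 2;
     0, 0, y, 0;
     0, 0, 0, y ^ 2]

/-- The unipotent factor of the fundamental matrix, as a function of two elliptic integrals. -/
def unipFactor (c p r : ℂ) : Matrix (Fin 4) (Fin 4) ℂ :=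
  !![1, c * (c - 1) * p / 2, (2 * c - 1) * p / 2 + c * (c - 1) * r / 4,
      (2 * c - 1) * (c * (c - 1)) * p ^ 2 / 8 + (c * (c - 1)) ^ 2 * (p * r) / 8;
     0, 1, 0, c * (c - 1) * r / 4;
     0, 0, 1, c * (c - 1) * p / 2;
     0, 0, 0, 1]

theorem det_algFactor (k0 k1 kt c z y : ℂ) : (algFactor k0 k1 kt c z y).det = y ^ 4 := by
  have h : (algFactor k0 k1 kt c z y).IsUpperTriangular := by
    intro i j hij
    fin_cases i <;> fin_cases j <;> first | rfl | (exfalso; revert hij; decide)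
  rw [Matrix.det_of_isUpperTriangular h, Fin.prod_univ_four]
  simp [algFactor]
  ring

theorem det_unipFactor (c p r : ℂ) : (unipFactor c p r).det = 1 := by
  have h : (unipFactor c p r).IsUpperTriangular := by
    intro i j hij
    fin_cases i <;> fin_cases j <;> first | rfl | (exfalso; revert hij; decide)
  rw [Matrix.det_of_isUpperTriangular h, Fin.prod_univ_four]
  simp [unipFactor]

theorem unipFactor_zero (c : ℂ) : unipFactor c 0 0 = 1 := by
  ext i j
  fin_cases i <;> fin_cases j <;> simp [unipFactor]

/-- In the top right corner, the products of linear entries are exactly the polarization of the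
quadratic form. This additivity is the source of commutativity. -/
theorem unipFactor_mul (c p r p' r' : ℂ) :
    unipFactor c p r * unipFactor c p' r' = unipFactor c (p + p') (r + r') := by
  ext i j
  fin_cases i <;> fin_cases j <;> simp [unipFactor, Matrix.mul_apply, Fin.sum_univ_four] <;> ring

theorem algFactor_mul_unipFactor (k0 k1 kt c z y p r : ℂ) :
    algFactor k0 k1 kt c z y * unipFactor c p r =
      !![1, c * (c - 1) * p / 2, (2 * c - 1) * p / 2 + c * (c - 1) * r / 4,
          (2 * c - 1) * (c * (c - 1)) * p ^ 2 / 8 + (c * (c - 1)) ^ 2 * (p * r) / 8;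
        0, y, -(y / (2 * (z - c))),
          y * (c * (c - 1) * r / 4) - y / (2 * (z - c)) * (c * (c - 1) * p / 2)
            + polyF k0 k1 kt c z / 2;
        0, 0, y, y * (c * (c - 1) * p / 2);
        0, 0, 0, y ^ 2] := by
  ext i j
  fin_cases i <;> fin_cases j <;>
    simp [algFactor, unipFactor, Matrix.mul_apply, Fin.sum_univ_four]
  ring

/-- After cancellation only y and z - c remain in denominators, the ones that occur in the frame. -/
theorem secondVariational_eq (k0 k1 kt : ℂ) {c z y : ℂ} (h : y ^ 2 = polyE c z)
    (hE : polyE c z ≠ 0) :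
    secondVariational k0 k1 kt c z =
      !![0, c * (c - 1) / (2 * y ^ 2), (2 * c - 1 + c * (c - 1) / (z - c)) / (2 * y ^ 2),
          -(c * (c - 1) * polyF k0 k1 kt c z) / (4 * y ^ 4);
        0, polyEDeriv c z / (2 * y ^ 2), 1 / (2 * (z - c) ^ 2),
          polyFDeriv k0 k1 kt c z / (2 * y ^ 2)
            - polyEDeriv c z * polyF k0 k1 kt c z / (4 * y ^ 4);
        0, 0, polyEDeriv c z / (2 * y ^ 2), c * (c - 1) / (2 * y ^ 2);
        0, 0, 0, polyEDeriv c z / y ^ 2] := by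
  obtain ⟨h0, h1, hc⟩ := ne_of_polyE_ne_zero hE
  have h1' := sub_ne_zero.2 h1
  have hc' := sub_ne_zero.2 hc
  have hG : coeffG c z = (2 * c - 1 + c * (c - 1) / (z - c)) / (2 * polyE c z) := by
    unfold coeffG polyE
    field_simp
  have hEe : coeffE c z = 1 / (2 * (z - c) ^ 2) := by
    unfold coeffE
    rw [polyEDeriv_eq]
    unfold polyE
    field_simp
    ring
  have hD : coeffD k0 k1 kt c z = polyFDeriv k0 k1 kt c z / (2 * polyE c z)
      - polyEDeriv c z * polyF k0 k1 kt c z / (4 * polyE c z ^ 2) := by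
    unfold coeffD
    field_simp
    ring
  have h4 : y ^ 4 = polyE c z ^ 2 := by rw [← h]; ring
  have hA : 2 * coeffA c z = polyEDeriv c z / polyE c z := by
    unfold coeffA
    field_simp
  unfold secondVariational
  rw [hG, hEe, hD, hA, h, h4]
  rfl

theorem hasDerivAt_fundamentalMatrix (k0 k1 kt : ℂ) {c z : ℂ} {Y P R : ℂ → ℂ}
    (h : IsEllipticFrameAt c Y P R z) (i j : Fin 4) :
    HasDerivAt (fun w => (algFactor k0 k1 kt c w (Y w) * unipFactor c (P w) (R w)) i j)
      ((secondVariational k0 k1 kt c z *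
        (algFactor k0 k1 kt c z (Y z) * unipFactor c (P z) (R z))) i j) z := by
  have hc := sub_ne_zero.2 (ne_of_polyE_ne_zero h.polyE_ne).2.2
  have hy := h.ne_zero
  have dY := h.deriv_root
  have dP := h.deriv_first
  have dR := h.deriv_second
  have dF := hasDerivAt_polyF k0 k1 kt c z
  have dC : HasDerivAt (fun w : ℂ => 2 * (w - c)) 2 z := by
    simpa using ((hasDerivAt_id z).sub_const c).const_mul (2 : ℂ)
  have dQ := dY.fun_div dC (mul_ne_zero two_ne_zero hc)
  have dP' := (dP.const_mul (c * (c - 1))).div_const 2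
  have dR' := (dR.const_mul (c * (c - 1))).div_const 4
  rw [secondVariational_eq k0 k1 kt h.sq_eq h.polyE_ne]
  simp only [algFactor_mul_unipFactor]
  fin_cases i <;> fin_cases j <;>
    simp [Matrix.mul_apply, Fin.sum_univ_four, hasDerivAt_const, -mul_eq_zero]
  · refine dP'.congr_deriv ?_
    field_simp
  · refine (((dP.const_mul (2 * c - 1)).div_const 2).fun_add dR').congr_deriv ?_
    field_simp
    ring
  -- Top right entry: the F terms contributed by b and f cancel, and what remains is a combination
  -- of p p' and (p r)', hence exact.
  · refine ((((dP.fun_pow 2).const_mul ((2 * c - 1) * (c * (c - 1)))).div_const 8).fun_add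
      (((dP.fun_mul dR).const_mul ((c * (c - 1)) ^ 2)).div_const 8)).congr_deriv ?_
    field_simp
    ring
  · refine dY.congr_deriv ?_
    field_simp
  -- Here e = 1 / (2(z - c)²) is the derivative of -1 / (2(z - c)).
  · refine dQ.fun_neg.congr_deriv ?_
    field_simp
    ring
  -- F/2 is a particular solution for the source d y². Integrating p/(z - c)² by parts produces the
  -- second elliptic integral r.
  · refine (((dY.fun_mul dR').fun_sub (dQ.fun_mul dP')).fun_add (dF.div_const 2)).congr_deriv ?_
    field_simp
    ring
  · refine dY.congr_deriv ?_
    field_simp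
  · refine (dY.fun_mul dP').congr_deriv ?_
    field_simp
  · refine (dY.fun_pow 2).congr_deriv ?_
    field_simp
    norm_num
    ring

/-! ### Continuation of solutions: existence and uniqueness -/

theorem isContinuationAlong_of_isFrameLiftAt (k0 k1 kt : ℂ) {c : ℂ} {γ : unitInterval → ℂ}
    {g : unitInterval → ℂ × ℂ × ℂ} (hg : ∀ s, IsFrameLiftAt c γ g s)
    (C : Matrix (Fin 4) (Fin 4) ℂ) :
    IsContinuationAlong (secondVariational k0 k1 kt c) γ fun s =>
      algFactor k0 k1 kt c (γ s) (g s).1 * unipFactor c (g s).2.1 (g s).2.2 * C := by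
  intro s₀
  obtain ⟨Y, P, R, h, hs⟩ := hg s₀
  refine ⟨fun z => algFactor k0 k1 kt c z (Y z) * unipFactor c (P z) (R z) * C, ?_, ?_⟩
  · filter_upwards [h] with z hz i j
    have hd : HasDerivAt (fun w => ∑ k, (algFactor k0 k1 kt c w (Y w) *
        unipFactor c (P w) (R w)) i k * C k j) _ z :=
      HasDerivAt.fun_sum fun k _ =>
        (hasDerivAt_fundamentalMatrix k0 k1 kt hz i k).mul_const (C k j)
    rw [← Matrix.mul_apply, Matrix.mul_assoc] at hd
    exact hd
  · filter_upwards [hs] with s hs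
    rw [hs]

theorem det_fundamentalMatrix_ne_zero (k0 k1 kt : ℂ) {c z y : ℂ} (hy : y ≠ 0) (p r : ℂ) :
    (algFactor k0 k1 kt c z y * unipFactor c p r).det ≠ 0 := by
  rw [Matrix.det_mul, det_algFactor, det_unipFactor, mul_one]
  exact pow_ne_zero 4 hy

/-- Analytic continuation along a path is determined by its initial value. -/
theorem IsContinuationAlong.eq_of_zero_eq {k0 k1 kt c : ℂ} {γ : unitInterval → ℂ}
    (hγ : Continuous γ) (hE : ∀ s, polyE c (γ s) ≠ 0)
    {Φ Ψ : unitInterval → Matrix (Fin 4) (Fin 4) ℂ}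
    (hΦ : IsContinuationAlong (secondVariational k0 k1 kt c) γ Φ)
    (hΨ : IsContinuationAlong (secondVariational k0 k1 kt c) γ Ψ) (h0 : Φ 0 = Ψ 0) : Φ = Ψ := by
  -- Near s the two continuations are M K and M K' with M invertible, so they agree at one nearby
  -- time exactly when K = K'.
  have key : ∀ s, ∀ᶠ t in 𝓝 s, (Φ s = Ψ s ↔ Φ t = Ψ t) := by
    intro s
    obtain ⟨ρ₀, hρ₀, Y, P, R, hfr⟩ := exists_ball_isEllipticFrameAt (hE s)
    obtain ⟨V, hV, hΦV⟩ := hΦ s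
    obtain ⟨W, hW, hΨW⟩ := hΨ s
    have hfr' : ∀ᶠ z in 𝓝 (γ s), IsEllipticFrameAt c Y P R z := by
      filter_upwards [Metric.ball_mem_nhds _ hρ₀] with z hz using hfr z hz
    obtain ⟨ρ, hρ, hall⟩ := Metric.eventually_nhds_iff_ball.1 ((hV.and hW).and hfr')
    set M : ℂ → Matrix (Fin 4) (Fin 4) ℂ :=
      fun z => algFactor k0 k1 kt c z (Y z) * unipFactor c (P z) (R z) with hM
    have hdet : ∀ z ∈ Metric.ball (γ s) ρ, (M z).det ≠ 0 := fun z hz =>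
      det_fundamentalMatrix_ne_zero k0 k1 kt (hall z hz).2.ne_zero _ _
    have hMd : ∀ z ∈ Metric.ball (γ s) ρ, ∀ i j, HasDerivAt (fun w => M w i j)
        ((secondVariational k0 k1 kt c z * M z) i j) z := fun z hz i j =>
      hasDerivAt_fundamentalMatrix k0 k1 kt (hall z hz).2 i j
    obtain ⟨K, hK⟩ := exists_eq_mul_of_hasDerivAt Metric.isOpen_ball
      (convex_ball _ _).isPreconnected hMd (fun z hz => (hall z hz).1.1) hdet
    obtain ⟨K', hK'⟩ := exists_eq_mul_of_hasDerivAt Metric.isOpen_ball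
      (convex_ball _ _).isPreconnected hMd (fun z hz => (hall z hz).1.2) hdet
    have hiff : ∀ᶠ t in 𝓝 s, (Φ t = Ψ t ↔ K = K') := by
      filter_upwards [hΦV, hΨW, hγ.continuousAt.preimage_mem_nhds (Metric.ball_mem_nhds _ hρ)]
        with t h1 h2 h3
      rw [h1, h2, hK _ h3, hK' _ h3]
      refine ⟨fun h => ?_, fun h => h ▸ rfl⟩
      have := congrArg (fun N => (M (γ t))⁻¹ * N) h
      simpa only [Matrix.nonsing_inv_mul_cancel_left _ _ (hdet _ h3).isUnit] using this
    filter_upwards [hiff] with t ht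
    rw [hiff.self_of_nhds, ht]
  funext t
  refine isPreconnected_univ.induction₂' (fun x y => Φ x = Ψ x → Φ y = Ψ y) (fun x _ => ?_)
    (fun x y z _ _ _ h1 h2 h => h2 (h1 h)) (Set.mem_univ 0) (Set.mem_univ t) h0
  rw [nhdsWithin_univ]
  filter_upwards [key x] with y hy
  exact ⟨hy.1, hy.2⟩

theorem IsContinuationAlong.mul_const {A : ℂ → Matrix (Fin 4) (Fin 4) ℂ} {γ : unitInterval → ℂ}
    {Φ : unitInterval → Matrix (Fin 4) (Fin 4) ℂ} (h : IsContinuationAlong A γ Φ)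
    (C : Matrix (Fin 4) (Fin 4) ℂ) : IsContinuationAlong A γ fun s => Φ s * C := by
  intro s₀
  obtain ⟨W, hW, hΦ⟩ := h s₀
  refine ⟨fun z => W z * C, ?_, ?_⟩
  · filter_upwards [hW] with z hz i j
    have hd : HasDerivAt (fun w => ∑ k, W w i k * C k j) _ z :=
      HasDerivAt.fun_sum fun k _ => (hz i k).mul_const (C k j)
    rw [← Matrix.mul_apply, Matrix.mul_assoc] at hd
    exact hd
  · filter_upwards [hΦ] with s hs
    rw [hs]

theorem IsContinuationAlong.comp {A : ℂ → Matrix (Fin 4) (Fin 4) ℂ} {γ γ' : unitInterval → ℂ}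
    {Φ : unitInterval → Matrix (Fin 4) (Fin 4) ℂ} (h : IsContinuationAlong A γ Φ)
    {φ : unitInterval → unitInterval} (hφ : Continuous φ) (hγ' : ∀ s, γ' s = γ (φ s)) :
    IsContinuationAlong A γ' fun s => Φ (φ s) := by
  intro s₀
  obtain ⟨W, hW, hΦ⟩ := h (φ s₀)
  refine ⟨W, by rwa [hγ'], ?_⟩
  filter_upwards [hφ.continuousAt.eventually hΦ] with s hs
  rw [hs, hγ']

/-! ### Concatenation and monodromy matrices -/

/-- The parametrization of the first half of the unit interval. -/
def firstHalf (s : unitInterval) : unitInterval :=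
  ⟨s / 2, by constructor <;> linarith [s.2.1, s.2.2]⟩

/-- The parametrization of the second half of the unit interval. -/
def secondHalf (s : unitInterval) : unitInterval :=
  ⟨(1 + s) / 2, by constructor <;> linarith [s.2.1, s.2.2]⟩

theorem continuous_firstHalf : Continuous firstHalf := by unfold firstHalf; fun_prop

theorem continuous_secondHalf : Continuous secondHalf := by unfold secondHalf; fun_prop

theorem trans_firstHalf {V : Type*} [TopologicalSpace V] {x y z : V} (γ : Path x y) (δ : Path y z)
    (s : unitInterval) : γ.trans δ (firstHalf s) = γ s := by
  rw [Path.trans_apply, dif_pos (by simp only [firstHalf]; linarith [s.2.2])]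
  congr 1
  ext
  simp [firstHalf]
  ring

theorem trans_secondHalf {V : Type*} [TopologicalSpace V] {x y z : V} (γ : Path x y) (δ : Path y z)
    (s : unitInterval) : γ.trans δ (secondHalf s) = δ s := by
  rw [Path.trans_apply]
  split_ifs with h
  · have hs : s = 0 := by
      ext
      simp only [secondHalf] at h
      have := s.2.1
      change (s : ℝ) = 0
      linarith
    subst hs
    rw [Path.source]
    convert γ.target
    simp [secondHalf]
  · congr 1
    ext
    simp [secondHalf]
    ring

theorem Leaf.polyE_ne_zero {c : ℂ} (z : Leaf c) : polyE c z.1 ≠ 0 :=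
  PainleveSix.polyE_ne_zero z.2.1 z.2.2.1 z.2.2.2

theorem Leaf.continuous_coe {c : ℂ} {P P' : Leaf c} (γ : Path P P') :
    Continuous fun s => (γ s).1 := continuous_subtype_val.comp γ.continuous

/-- The right factor D⁻¹ X, with D the initial algebraic factor, imposes the value X at time 0. The
root y is kept because its end value determines the sheet. -/
theorem exists_isContinuationAlong (k0 k1 kt : ℂ) {c : ℂ} {P P' : Leaf c} (γ : Path P P')
    {y₀ : ℂ} (hy₀ : y₀ ^ 2 = polyE c P.1) (X : Matrix (Fin 4) (Fin 4) ℂ) :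
    ∃ (Φ : unitInterval → Matrix (Fin 4) (Fin 4) ℂ) (y : unitInterval → ℂ) (p r : ℂ),
      IsContinuationAlong (secondVariational k0 k1 kt c) (fun s => (γ s).1) Φ ∧ Φ 0 = X ∧
      Continuous y ∧ (∀ s, y s ^ 2 = polyE c (γ s).1) ∧ y 0 = y₀ ∧
      Φ 1 = algFactor k0 k1 kt c P'.1 (y 1) * unipFactor c p r *
        ((algFactor k0 k1 kt c P.1 y₀)⁻¹ * X) := by
  obtain ⟨g, hg0, hg⟩ := exists_isFrameLiftAt (c := c) (Leaf.continuous_coe γ)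
    (fun s => (γ s).polyE_ne_zero) (y₀ := y₀) (by simpa using hy₀)
  have hdet : (algFactor k0 k1 kt c P.1 y₀).det ≠ 0 := by
    rw [det_algFactor]
    refine pow_ne_zero 4 ?_
    rintro rfl
    exact P.polyE_ne_zero (by rw [← hy₀]; simp)
  refine ⟨_, fun s => (g s).1, (g 1).2.1, (g 1).2.2,
    isContinuationAlong_of_isFrameLiftAt k0 k1 kt hg
      ((algFactor k0 k1 kt c P.1 y₀)⁻¹ * X), ?_, ?_, fun s => (hg s).sq_eq, by simp [hg0], ?_⟩
  · simp only [hg0, Path.source, unipFactor_zero, mul_one]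
    exact Matrix.mul_nonsing_inv_cancel_left _ _ hdet.isUnit
  · exact continuous_iff_continuousAt.2 fun s =>
      (hg s).continuousAt_fst (Leaf.continuous_coe γ)
  · simp only [Path.target]

theorem existsUnique_isMonodromyMatrix (k0 k1 kt : ℂ) {c : ℂ} {P : Leaf c} (γ : Path P P)
    (X : GL (Fin 4) ℂ) : ∃! T : GL (Fin 4) ℂ, IsMonodromyMatrix k0 k1 kt c γ X T := by
  obtain ⟨y₀, hy₀⟩ := IsAlgClosed.exists_pow_nat_eq (polyE c P.1) two_pos
  obtain ⟨Φ, y, p, r, hΦ, hΦ0, hy, hysq, hy0, hΦ1⟩ :=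
    exists_isContinuationAlong k0 k1 kt γ hy₀ X.1
  have hne : ∀ u : ℂ, u ^ 2 = polyE c P.1 → u ≠ 0 := by
    rintro u hu rfl
    exact P.polyE_ne_zero (by rw [← hu]; simp)
  have hdet : (Φ 1).det ≠ 0 := by
    have h1 : y 1 ≠ 0 := hne _ (by simpa using hysq 1)
    have h2 : ∀ D : Matrix (Fin 4) (Fin 4) ℂ, D.det ≠ 0 → (D⁻¹ * X.1).det ≠ 0 := by
      intro D hD
      rw [Matrix.det_mul, Matrix.det_nonsing_inv, Ring.inverse_eq_inv']
      exact mul_ne_zero (inv_ne_zero hD) X.det.ne_zero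
    rw [hΦ1, Matrix.det_mul]
    exact mul_ne_zero (det_fundamentalMatrix_ne_zero k0 k1 kt h1 p r)
      (h2 _ (by rw [det_algFactor]; exact pow_ne_zero 4 (hne _ hy₀)))
  refine ⟨X⁻¹ * Matrix.GeneralLinearGroup.mkOfDetNeZero (Φ 1) hdet, ⟨Φ, hΦ, hΦ0, ?_⟩, ?_⟩
  · rw [← Units.val_mul, mul_inv_cancel_left]
    rfl
  · rintro T ⟨Ψ, hΨ, hΨ0, hΨ1⟩
    have hEq := hΨ.eq_of_zero_eq (Leaf.continuous_coe γ) (fun s => (γ s).polyE_ne_zero) hΦ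
      (hΨ0.trans hΦ0.symm)
    rw [eq_inv_mul_iff_mul_eq]
    ext1
    rw [Units.val_mul, ← hΨ1, hEq]
    rfl

/-- After γ the solution is X S; along δ the constant S is carried on the right and X becomes X T,
hence the reversed order. -/
theorem IsMonodromyMatrix.trans {k0 k1 kt c : ℂ} {P : Leaf c} {γ δ : Path P P}
    {X S T : GL (Fin 4) ℂ} (hγ : IsMonodromyMatrix k0 k1 kt c γ X S)
    (hδ : IsMonodromyMatrix k0 k1 kt c δ X T) :
    IsMonodromyMatrix k0 k1 kt c (γ.trans δ) X (T * S) := by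
  obtain ⟨Φ, hΦ, hΦ0, hΦ1⟩ := hγ
  obtain ⟨Ψ, hΨ, hΨ0, hΨ1⟩ := hδ
  -- No gluing is needed: a continuation along the whole path exists already, and uniqueness
  -- identifies its two halves.
  obtain ⟨U, ⟨Ω, hΩ, hΩ0, hΩ1⟩, -⟩ := existsUnique_isMonodromyMatrix k0 k1 kt (γ.trans δ) X
  have h1 := (hΩ.comp continuous_firstHalf (γ' := fun s => (γ s).1)
    (fun s => by rw [trans_firstHalf])).eq_of_zero_eq (Leaf.continuous_coe γ)
    (fun s => (γ s).polyE_ne_zero) hΦ (by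
      rw [hΦ0, ← hΩ0]
      congr 1
      ext
      simp [firstHalf])
  have hmid : Ω (secondHalf 0) = X.1 * S.1 := by
    rw [← hΦ1, ← h1]
    congr 1
    ext
    simp [firstHalf, secondHalf]
  have h2 := (hΩ.comp continuous_secondHalf (γ' := fun s => (δ s).1)
    (fun s => by rw [trans_secondHalf])).eq_of_zero_eq (Leaf.continuous_coe δ)
    (fun s => (δ s).polyE_ne_zero) (hΨ.mul_const S.1) (by rw [hmid, hΨ0])
  refine ⟨Ω, hΩ, hΩ0, ?_⟩
  have : (1 : unitInterval) = secondHalf 1 := by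
    ext
    norm_num [secondHalf]
  rw [this, congrFun h2 1, hΨ1, Units.val_mul, Matrix.mul_assoc]

/-! ### The double covering and its sheets -/

/-- The involution `(z, y) ↦ (z, -y)` of the elliptic curve. -/
def Curve.swap {c : ℂ} (q : Curve c) : Curve c :=
  ⟨(q.1.1, -q.1.2), by simpa using q.2.1, q.2.2⟩

theorem Curve.continuous_swap {c : ℂ} : Continuous (Curve.swap (c := c)) :=
  Continuous.subtype_mk ((continuous_fst.comp continuous_subtype_val).prodMk
    (continuous_snd.comp continuous_subtype_val).neg) _

theorem Curve.swap_swap {c : ℂ} (q : Curve c) : q.swap.swap = q :=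
  Subtype.ext (Prod.ext rfl (neg_neg _))

theorem Curve.snd_ne_zero {c : ℂ} (q : Curve c) : q.1.2 ≠ 0 := by
  intro h
  refine q.proj.polyE_ne_zero (Eq.trans q.2.1.symm ?_)
  simp [h]

/-- A loop in the leaf lifts to the curve, either to a loop or to a path that ends on the
opposite sheet. -/
theorem exists_lift_loop {c : ℂ} {Q : Curve c} (γ : Path Q.proj Q.proj) :
    (∃ α : Path Q Q, α.map Curve.continuous_proj = γ) ∨
      ∃ β : Path Q Q.swap, (β.map Curve.continuous_proj : Path Q.proj Q.proj) = γ := by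
  -- Only the continued square root matters here, so the parameters and the initial matrix are
  -- arbitrary.
  obtain ⟨-, y, -, -, -, -, hy, hysq, hy0, -⟩ :=
    exists_isContinuationAlong 0 0 0 γ (y₀ := Q.1.2) Q.2.1 1
  set f : unitInterval → Curve c := fun s => ⟨((γ s).1, y s), hysq s, (γ s).2⟩
  have hfc : Continuous f := Continuous.subtype_mk ((Leaf.continuous_coe γ).prodMk hy) _
  have hf0 : f 0 = Q := Subtype.ext (Prod.ext (congrArg Subtype.val γ.source) hy0)
  have h1 : y 1 ^ 2 = Q.1.2 ^ 2 := by
    rw [hysq 1, Path.target]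
    exact Q.2.1.symm
  rcases sq_eq_sq_iff_eq_or_eq_neg.1 h1 with h | h
  · have hf1 : f 1 = Q := Subtype.ext (Prod.ext (congrArg Subtype.val γ.target) h)
    exact Or.inl ⟨⟨⟨f, hfc⟩, hf0, hf1⟩, rfl⟩
  · have hf1 : f 1 = Q.swap := Subtype.ext (Prod.ext (congrArg Subtype.val γ.target) h)
    exact Or.inr ⟨⟨⟨f, hfc⟩, hf0, hf1⟩, rfl⟩

/-- `T` is the monodromy matrix along the projection of a path on the curve that joins the two
points over the base point. -/
def IsSheetMonodromyMatrix (k0 k1 kt c : ℂ) {Q : Curve c} (β : Path Q Q.swap)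
    (X T : GL (Fin 4) ℂ) : Prop :=
  IsMonodromyMatrix k0 k1 kt c (P := Q.proj) (β.map Curve.continuous_proj) X T

/-- On a closed lift the root returns to its initial value, so only the increments of p and r
survive. -/
theorem IsCurveMonodromyMatrix.eq_unip {k0 k1 kt c : ℂ} {Q : Curve c} {α : Path Q Q}
    {X T : GL (Fin 4) ℂ} (h : IsCurveMonodromyMatrix k0 k1 kt c α X T) :
    ∃ p r, X.1 * T.1 = algFactor k0 k1 kt c Q.1.1 Q.1.2 * unipFactor c p r *
      ((algFactor k0 k1 kt c Q.1.1 Q.1.2)⁻¹ * X.1) := by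
  obtain ⟨Φ, hΦ, hΦ0, hΦ1⟩ := h
  obtain ⟨Ψ, y, p, r, hΨ, hΨ0, hy, hysq, hy0, hΨ1⟩ :=
    exists_isContinuationAlong k0 k1 kt (α.map Curve.continuous_proj) (y₀ := Q.1.2) Q.2.1 X.1
  -- The continued root and the second coordinate of the lift are square roots of the same function,
  -- equal at time 0.
  have hyα : y 1 = (α 1).1.2 := isPreconnected_univ.eq_of_sq_eq (f := y)
    (g := fun s => (α s).1.2) (y := (0 : unitInterval)) hy.continuousOn
    (continuous_snd.comp (continuous_subtype_val.comp α.continuous)).continuousOn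
    (fun s _ => (hysq s).trans (α s).2.1.symm) (fun {s} _ => (α s).snd_ne_zero)
    (Set.mem_univ _) (by simp [hy0]) (Set.mem_univ 1)
  have hEq := hΦ.eq_of_zero_eq (Leaf.continuous_coe _) (fun s => Leaf.polyE_ne_zero _) hΨ
    (hΦ0.trans hΨ0.symm)
  refine ⟨p, r, ?_⟩
  rw [← hΦ1, hEq, hΨ1, hyα, Path.target]
  rfl

/-- Both matrices are conjugates of unipotent factors by the same X⁻¹ D; their products in either
order involve the same sums of increments. -/
theorem IsCurveMonodromyMatrix.commute {k0 k1 kt c : ℂ} {Q : Curve c} {α β : Path Q Q}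
    {X S T : GL (Fin 4) ℂ} (hα : IsCurveMonodromyMatrix k0 k1 kt c α X S)
    (hβ : IsCurveMonodromyMatrix k0 k1 kt c β X T) : S * T = T * S := by
  obtain ⟨p, r, h⟩ := hα.eq_unip
  obtain ⟨p', r', h'⟩ := hβ.eq_unip
  have hdet : IsUnit (algFactor k0 k1 kt c Q.1.1 Q.1.2).det := by
    rw [det_algFactor]
    exact (pow_ne_zero 4 Q.snd_ne_zero).isUnit
  set D := algFactor k0 k1 kt c Q.1.1 Q.1.2
  have hprod : ∀ (u v : ℂ) (A : Matrix (Fin 4) (Fin 4) ℂ), ∀ u' v' : ℂ,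
      D * unipFactor c u v * (D⁻¹ * (D * unipFactor c u' v' * (D⁻¹ * A)))
        = D * unipFactor c (u + u') (v + v') * (D⁻¹ * A) := by
    intro u v A u' v'
    rw [Matrix.mul_assoc D (unipFactor c u' v'), Matrix.nonsing_inv_mul_cancel_left _ _ hdet,
      ← unipFactor_mul]
    simp only [Matrix.mul_assoc]
  have hmul : ∀ (A B : GL (Fin 4) ℂ) (u v u' v' : ℂ),
      X.1 * A.1 = D * unipFactor c u v * (D⁻¹ * X.1) →
      X.1 * B.1 = D * unipFactor c u' v' * (D⁻¹ * X.1) →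
      (X * (A * B)).1 = D * unipFactor c (u + u') (v + v') * (D⁻¹ * X.1) := by
    intro A B u v u' v' hA hB
    rw [← hprod, ← hB, Units.val_mul, Units.val_mul, ← Matrix.mul_assoc, hA]
    simp only [Matrix.mul_assoc]
  have h1 := hmul S T p r p' r' h h'
  have h2 := hmul T S p' r' p r h' h
  rw [add_comm p', add_comm r', ← h1] at h2
  exact (mul_left_cancel (Units.ext h2)).symm

theorem IsCurveMonodromyMatrix.mul_sheet {k0 k1 kt c : ℂ} {Q : Curve c} {α : Path Q Q}
    {β : Path Q Q.swap} {X S T : GL (Fin 4) ℂ} (hα : IsCurveMonodromyMatrix k0 k1 kt c α X S)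
    (hβ : IsSheetMonodromyMatrix k0 k1 kt c β X T) :
    IsSheetMonodromyMatrix k0 k1 kt c (α.trans β) X (T * S) := by
  have := IsMonodromyMatrix.trans hα hβ
  unfold IsSheetMonodromyMatrix
  rwa [Path.map_trans]

/-- The sheet involution moves the second path to start where the first ends; it then ends at Q, and
its projection is unchanged. -/
theorem IsSheetMonodromyMatrix.mul_sheet {k0 k1 kt c : ℂ} {Q : Curve c} {β β' : Path Q Q.swap}
    {X S T : GL (Fin 4) ℂ} (hβ : IsSheetMonodromyMatrix k0 k1 kt c β X S)
    (hβ' : IsSheetMonodromyMatrix k0 k1 kt c β' X T) :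
    ∃ α : Path Q Q, IsCurveMonodromyMatrix k0 k1 kt c α X (T * S) := by
  refine ⟨(β.trans (β'.map Curve.continuous_swap)).cast rfl Q.swap_swap.symm, ?_⟩
  have := IsMonodromyMatrix.trans hβ hβ'
  have hpath : ((β.trans (β'.map Curve.continuous_swap)).cast rfl Q.swap_swap.symm).map
      Curve.continuous_proj = Path.trans (y := Q.proj) (β.map Curve.continuous_proj)
        (β'.map Curve.continuous_proj) := by
    ext1
    funext s
    refine Eq.trans ?_ (Path.trans_apply (y := Q.proj) _ _ s).symm
    simp only [Path.map_coe, Path.cast_coe, Function.comp_apply, Path.trans_apply]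
    split_ifs <;> rfl
  unfold IsCurveMonodromyMatrix
  rwa [hpath]

theorem monodromyGroup_eq_closure_union (k0 k1 kt c : ℂ) (Q : Curve c) (X : GL (Fin 4) ℂ) :
    monodromyGroup k0 k1 kt c Q.proj X =
      Subgroup.closure ({T | ∃ α : Path Q Q, IsCurveMonodromyMatrix k0 k1 kt c α X T} ∪
        {T | ∃ β : Path Q Q.swap, IsSheetMonodromyMatrix k0 k1 kt c β X T}) := by
  unfold monodromyGroup
  congr 1
  ext T
  constructor
  · rintro ⟨γ, hγ⟩
    rcases exists_lift_loop γ with ⟨α, rfl⟩ | ⟨β, rfl⟩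
    · exact Or.inl ⟨α, hγ⟩
    · exact Or.inr ⟨β, hγ⟩
  · rintro (⟨α, h⟩ | ⟨β, h⟩)
    · exact ⟨_, h⟩
    · exact ⟨_, h⟩

theorem curveMonodromyGroup_commute (k0 k1 kt c : ℂ) (Q : Curve c) (X : GL (Fin 4) ℂ) :
    ∀ a ∈ curveMonodromyGroup k0 k1 kt c Q X, ∀ b ∈ curveMonodromyGroup k0 k1 kt c Q X,
      a * b = b * a := by
  have : IsMulCommutative (curveMonodromyGroup k0 k1 kt c Q X) :=
    Subgroup.isMulCommutative_closure fun x hx y hy => by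
      obtain ⟨α, hα⟩ := hx
      obtain ⟨β, hβ⟩ := hy
      exact hα.commute hβ
  intro a ha b hb
  exact congrArg Subtype.val (mul_comm' (⟨a, ha⟩ : curveMonodromyGroup k0 k1 kt c Q X) ⟨b, hb⟩)

theorem curveMonodromyGroup_isFiniteRelIndex (k0 k1 kt c : ℂ) (Q : Curve c) (X : GL (Fin 4) ℂ) :
    (curveMonodromyGroup k0 k1 kt c Q X).IsFiniteRelIndex
      (monodromyGroup k0 k1 kt c Q.proj X) := by
  rw [monodromyGroup_eq_closure_union]
  refine isFiniteRelIndex_closure_union _ _ ?_ ?_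
  · rintro a ⟨α, hα⟩ b ⟨β, hβ⟩
    exact ⟨_, hα.mul_sheet hβ⟩
  -- The order is swapped since concatenation reverses products.
  · rintro a ⟨β, hβ⟩ b ⟨β', hβ'⟩
    exact hβ'.mul_sheet hβ

end PainleveSix

end

theorem corollary1 (k0 k1 kt c : ℂ) (hc0 : c ≠ 0) (hc1 : c ≠ 1)
    (Q : PainleveSix.Curve c) (X : GL (Fin 4) ℂ) :
    (∀ γ : Path Q.proj Q.proj, ∃! T : GL (Fin 4) ℂ,
      PainleveSix.IsMonodromyMatrix k0 k1 kt c γ X T) ∧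
    (∀ (α β : Path Q Q) (Tα Tβ : GL (Fin 4) ℂ),
      PainleveSix.IsCurveMonodromyMatrix k0 k1 kt c α X Tα →
      PainleveSix.IsCurveMonodromyMatrix k0 k1 kt c β X Tβ →
      Tα * Tβ = Tβ * Tα) ∧
    PainleveSix.curveMonodromyGroup k0 k1 kt c Q X
      ≤ PainleveSix.monodromyGroup k0 k1 kt c Q.proj X ∧
    (PainleveSix.curveMonodromyGroup k0 k1 kt c Q X).IsFiniteRelIndex
      (PainleveSix.monodromyGroup k0 k1 kt c Q.proj X) ∧
    PainleveSix.IsVirtuallyCommutative (PainleveSix.monodromyGroup k0 k1 kt c Q.proj X) := by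
  have hfin := PainleveSix.curveMonodromyGroup_isFiniteRelIndex k0 k1 kt c Q X
  refine ⟨fun γ => PainleveSix.existsUnique_isMonodromyMatrix k0 k1 kt γ X,
    fun _ _ _ _ hα hβ => hα.commute hβ, ?_, hfin,
    PainleveSix.isVirtuallyCommutative_of_isFiniteRelIndex _ _
      (PainleveSix.curveMonodromyGroup_commute k0 k1 kt c Q X)⟩
  rw [PainleveSix.monodromyGroup_eq_closure_union]
  exact Subgroup.closure_mono Set.subset_union_left
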